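/- Let $n\ge 1$, equip $\mathbb{C}^n$ with the standard symplectic form $\omega=\frac{1}{2i}\sum_{k=1}^n dz_k\wedge d\bar z_k$, and let $\pi:\mathbb{C}^n\to\mathbb{R}^n_{\ge 0}$ be the map $\pi(z_1,\dots,z_n)=(\pi|z_1|^2,\dots,\pi|z_n|^2)$. For $a_1,\dots,a_n>0$ and $r>0$ put $$L(a_1,\dots,a_n)=\pi^{-1}\Big(\bigcup_{k=1}^n\{x\in\mathbb{R}^n_{\ge 0} : x_k<a_k\}\Big),\qquad Z(r)=\pi^{-1}\big(\{x\in\mathbb{R}^n_{\ge 0} : x_n<r\}\big).$$ If $r>a_1+\dots+a_n$, then there exists a symplectic embedding $L(a_1,\dots,a_n)\hookrightarrow Z(r)$, that is, a smooth embedding $\varphi$ of the open set $L(a_1,\dots,a_n)$ into $\mathbb{C}^n$ whose image is contained in $Z(r)$ and which satisfies $\varphi^*\omega=\omega$. -/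

import Mathlib

open scoped ContDiff ComplexConjugate

noncomputable section

namespace Toric

/-- The map `π : ℂⁿ → ℝⁿ_{≥ 0}`, `(z₁, …, zₙ) ↦ (π |z₁|², …, π |zₙ|²)`. -/
def momentMap {n : ℕ} (z : Fin n → ℂ) : Fin n → ℝ :=
  fun k => Real.pi * ‖z k‖ ^ 2

/-- The toric domain `X_Ω = π⁻¹(Ω)`. -/
def toricDomain {n : ℕ} (Ω : Set (Fin n → ℝ)) : Set (Fin n → ℂ) :=
  momentMap ⁻¹' Ω

/-- The cylinder `Z(r) = π⁻¹ {x ≥ 0 | x_last < r}` in complex dimension `n + 1 ≥ 1`. -/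
def cylinder (n : ℕ) (r : ℝ) : Set (Fin (n + 1) → ℂ) :=
  toricDomain {x | (∀ k, 0 ≤ x k) ∧ x (Fin.last n) < r}

/-- The `L`-shaped domain `L(a) = π⁻¹ (⋃ₖ {x ≥ 0 | xₖ < aₖ})`. -/
def lShaped {n : ℕ} (a : Fin n → ℝ) : Set (Fin n → ℂ) :=
  toricDomain (⋃ k, {x | (∀ j, 0 ≤ x j) ∧ x k < a k})

/-- The standard symplectic form `ω = (1 / 2i) ∑ dzₖ ∧ dz̄ₖ` on `ℂⁿ`, evaluated on two tangent
vectors, in real coordinates `z = x + i y`; see `standardForm_eq`. -/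
def standardForm {n : ℕ} (u v : Fin n → ℂ) : ℝ :=
  ∑ k, ((u k).im * (v k).re - (u k).re * (v k).im)

theorem standardForm_eq {n : ℕ} (u v : Fin n → ℂ) :
    (standardForm u v : ℂ) =
      1 / (2 * Complex.I) * ∑ k, (u k * conj (v k) - v k * conj (u k)) := by
  unfold standardForm
  rw [Finset.mul_sum, Complex.ofReal_sum]
  refine Finset.sum_congr rfl fun k _ => ?_
  rw [one_div, eq_inv_mul_iff_mul_eq₀ (by simp)]
  apply Complex.ext <;> simp <;> ring

/-- `φ` restricts to a symplectic embedding of the open set `U ⊆ ℂⁿ` into `V ⊆ ℂⁿ`: on `U` it is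
smooth (in the real sense), a homeomorphism onto its image, maps `U` into `V`, and satisfies
`φ^* ω = ω`. (It is then an immersion, since `ω` is nondegenerate.) -/
structure IsSymplecticEmbedding {n : ℕ} (U V : Set (Fin n → ℂ))
    (φ : (Fin n → ℂ) → (Fin n → ℂ)) : Prop where
  contDiffOn : ContDiffOn ℝ ∞ φ U
  isEmbedding : Topology.IsEmbedding (U.domRestrict φ)
  mapsTo : Set.MapsTo φ U V
  pullback_eq : ∀ z ∈ U, ∀ u v : Fin n → ℂ,
    standardForm (fderiv ℝ φ z u) (fderiv ℝ φ z v) = standardForm u v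

end Toric

end

namespace Toric

open MeasureTheory Set Filter Topology

/-! ### Smooth functions of one real variable with prescribed primitives -/

/-! Write `z k = x_k + i y_k`. An area-preserving map in each factor
(`exists_isSymplecticOn_halfStrip`) puts the plane into the half-strip `x_k > 0`, `0 < y_k < 1 + δ`,
with the disc of area `a k` going to `x_k < a k + δ`. A point of the `L`-shaped domain then has `x_j
< a j + δ` for at least one `j`.

Choose `v k`, close to `1` on `[0, a k + δ]` and with small integral elsewhere, let `V k` be a
primitive bounded by `a k + 3δ`, and let `T k` be a primitive of `t k = 1 + δ - v k > 0`. The change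
of positions to `s = ∑ V k (x_k)` and the differences `T k (x_k) - T o (x_o)`, `k ≠ o`, is
injective, and its cotangent lift is symplectic (`isSymplecticOn_cotangentLift`). The momentum
conjugate to `s` is `Q = (∑ y_k / t k) / (∑ v k / t k)`. Where `v j` is near `1`, the weight `1 / t
j` is huge and forces `Q` below roughly `1` (`sumMomentum_bounds`).

So the pair `(s, Q)` stays in a rectangle of area close to `∑ a k`, which symplectic polar
coordinates (`exists_isSymplecticOn_polar`) turn into a disc of area less than `r`. -/

theorem hasDerivAt_setIntegral_Iic {v : ℝ → ℝ} (hc : Continuous v) (hi : Integrable v) (x : ℝ) :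
    HasDerivAt (fun y => ∫ t in Iic y, v t) (v x) x := by
  have h : (fun y => ∫ t in Iic y, v t) =
      fun y => (∫ t in (0 : ℝ)..y, v t) + ∫ t in Iic (0 : ℝ), v t := by
    funext y
    rw [← intervalIntegral.integral_Iic_sub_Iic hi.integrableOn hi.integrableOn, sub_add_cancel]
  rw [h]
  exact (hc.integral_hasStrictDerivAt 0 x).hasDerivAt.add_const _

theorem setIntegral_pos_of_pos {v : ℝ → ℝ} (hi : Integrable v) (hpos : ∀ x, 0 < v x)
    {s : Set ℝ} (hs : volume s ≠ 0) : 0 < ∫ t in s, v t := by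
  rw [integral_pos_iff_support_of_nonneg (fun x => (hpos x).le) hi.integrableOn]
  have : Function.support v = univ := by
    ext x; simp [(hpos x).ne']
  rw [this, Measure.restrict_apply_univ]
  exact pos_iff_ne_zero.2 hs

/-- A nonnegative continuous integrable function has a smooth majorant, uniformly close to it and
with almost the same integral, together with a positive primitive of the majorant. -/
theorem exists_smooth_majorant {f : ℝ → ℝ} (hf : Continuous f) (hf0 : ∀ x, 0 ≤ f x)
    (hfi : Integrable f) {δ : ℝ} (hδ : 0 < δ) :
    ∃ v G : ℝ → ℝ, ContDiff ℝ ∞ v ∧ ContDiff ℝ ∞ G ∧ (∀ x, HasDerivAt G (v x) x) ∧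
      (∀ x, f x < v x ∧ v x < f x + δ) ∧ ∀ x, 0 < G x ∧ G x < (∫ t, f t) + δ := by
  -- The majorant will stay below `f + 2e`. Since `2e ≤ δ/4` and `∫ 2e = πδ/4 < δ`, both error
  -- bounds hold.
  set e : ℝ → ℝ := fun x => δ / 8 * (1 + x ^ 2)⁻¹ with he
  have hpos : ∀ x : ℝ, 0 < 1 + x ^ 2 := fun x => by positivity
  have hec : Continuous e :=
    continuous_const.mul ((by fun_prop : Continuous fun x : ℝ => 1 + x ^ 2).inv₀
      fun x => (hpos x).ne')
  have he0 : ∀ x, 0 < e x := fun x => by have := hpos x; simp only [he]; positivity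
  have he1 : ∀ x, e x ≤ δ / 8 := fun x => by
    have : (1 + x ^ 2)⁻¹ ≤ 1 := inv_le_one_of_one_le₀ (by nlinarith [sq_nonneg x])
    simp only [he]; nlinarith
  have hei : Integrable e := integrable_inv_one_add_sq.const_mul _
  have heint : ∫ x, e x = δ / 8 * Real.pi := by
    simp only [he]
    rw [integral_const_mul, integral_univ_inv_one_add_sq]
  -- Approximating `f + e` to within `e` places `v` strictly between `f` and `f + 2e`.
  obtain ⟨v, hv, hva, -⟩ := (hf.add hec).exists_contDiff_approx ⊤ hec he0
  have hva' : ∀ x, |v x - (f x + e x)| < e x := fun x => by simpa [Real.dist_eq] using hva x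
  have hv1 : ∀ x, f x < v x := fun x => by linarith [(abs_lt.1 (hva' x)).1]
  have hv2 : ∀ x, v x < f x + 2 * e x := fun x => by linarith [(abs_lt.1 (hva' x)).2]
  have hv0 : ∀ x, 0 < v x := fun x => (hf0 x).trans_lt (hv1 x)
  have hvi : Integrable v := by
    refine (hfi.add (hei.const_mul 2)).mono' hv.continuous.aestronglyMeasurable
      (Eventually.of_forall fun x => ?_)
    rw [Real.norm_of_nonneg (hv0 x).le]
    exact (hv2 x).le
  have hvint : ∫ x, v x < (∫ x, f x) + δ := by
    calc ∫ x, v x ≤ ∫ x, (f x + 2 * e x) :=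
          integral_mono hvi (hfi.add (hei.const_mul 2)) fun x => (hv2 x).le
      _ = (∫ x, f x) + 2 * (δ / 8 * Real.pi) := by
          rw [integral_add hfi (hei.const_mul 2), integral_const_mul, heint]
      _ < _ := by nlinarith [Real.pi_lt_four]
  have hder := hasDerivAt_setIntegral_Iic hv.continuous hvi
  refine ⟨v, fun x => ∫ t in Iic x, v t, hv, ?_, hder,
    fun x => ⟨hv1 x, by linarith [hv2 x, he1 x]⟩, fun x => ⟨?_, ?_⟩⟩
  · rw [contDiff_infty_iff_deriv]
    refine ⟨fun x => (hder x).differentiableAt, ?_⟩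
    rwa [funext fun x => (hder x).deriv]
  · exact setIntegral_pos_of_pos hvi hv0 (by simp)
  · have h := intervalIntegral.integral_Iic_add_Ioi (b := x) hvi.integrableOn hvi.integrableOn
    have := setIntegral_pos_of_pos hvi hv0 (s := Ioi x) (by simp)
    linarith

theorem exists_plateau {lo hi : ℝ} (h : lo < hi) {δ : ℝ} (hδ : 0 < δ) :
    ∃ f : ℝ → ℝ, Continuous f ∧ (∀ x, 0 ≤ f x ∧ f x ≤ 1) ∧ (∀ x ∈ Icc lo hi, f x = 1) ∧
      Integrable f ∧ ∫ x, f x ≤ hi - lo + δ := by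
  let f : ContDiffBump ((lo + hi) / 2) :=
    ⟨(hi - lo) / 2, (hi - lo + δ) / 2, by linarith, by linarith⟩
  refine ⟨f, f.continuous, fun x => ⟨f.nonneg, f.le_one⟩, fun x hx => ?_, f.integrable, ?_⟩
  · apply f.one_of_mem_closedBall
    rw [Real.closedBall_eq_Icc]
    refine ⟨?_, ?_⟩ <;> simp only [f] <;> linarith [hx.1, hx.2]
  · refine (f.integral_le_measure_closedBall volume).trans_eq ?_
    rw [Measure.real, Real.volume_closedBall, ENNReal.toReal_ofReal] <;> simp only [f] <;> linarith

/-- The integrand is the length of the vertical chord at `x` of the disc of radius `R`, so its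
integral is the area of the disc. -/
theorem integral_chord {R : ℝ} (hR : 0 < R) :
    Integrable (fun x : ℝ => 2 * √(R ^ 2 - x ^ 2)) ∧
      ∫ x : ℝ, 2 * √(R ^ 2 - x ^ 2) = Real.pi * R ^ 2 := by
  have hc : Continuous fun x : ℝ => 2 * √(R ^ 2 - x ^ 2) := by fun_prop
  have hsupp : Function.support (fun x : ℝ => 2 * √(R ^ 2 - x ^ 2)) ⊆ Ioc (-R) R := by
    intro x hx
    have h : 0 < R ^ 2 - x ^ 2 := by
      by_contra h
      exact hx (by simp [Real.sqrt_eq_zero_of_nonpos (not_lt.1 h)])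
    have := abs_lt.1 (abs_lt_of_sq_lt_sq (by linarith : x ^ 2 < R ^ 2) hR.le)
    exact ⟨this.1, this.2.le⟩
  refine ⟨?_, ?_⟩
  · rw [← integrableOn_iff_integrable_of_support_subset hsupp]
    exact (hc.integrableOn_Icc).mono_set Ioc_subset_Icc_self
  · rw [← setIntegral_eq_integral_of_forall_compl_eq_zero (s := Ioc (-R) R)
      fun x hx => by by_contra h; exact hx (hsupp h),
      ← intervalIntegral.integral_of_le (by linarith), intervalIntegral.integral_const_mul]
    have h := intervalIntegral.smul_integral_comp_mul_left (a := -1) (b := 1)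
      (fun x : ℝ => √(R ^ 2 - x ^ 2)) R
    rw [mul_neg_one, mul_one] at h
    rw [← h]
    have : ∀ x : ℝ, √(R ^ 2 - (R * x) ^ 2) = R * √(1 - x ^ 2) := fun x => by
      rw [show R ^ 2 - (R * x) ^ 2 = R ^ 2 * (1 - x ^ 2) by ring,
        Real.sqrt_mul (sq_nonneg R), Real.sqrt_sq hR.le]
    simp only [this, intervalIntegral.integral_const_mul, integral_sqrt_one_sub_sq, smul_eq_mul]
    ring

/-! ### Injective smooth maps preserving a bilinear form -/

/-- `φ` is smooth and injective on `U` and preserves the form `Ω` there. -/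
structure IsSymplecticOn {E : Type*} [NormedAddCommGroup E] [NormedSpace ℝ E]
    (Ω : E → E → ℝ) (U : Set E) (φ : E → E) : Prop where
  contDiffOn : ContDiffOn ℝ ∞ φ U
  injOn : InjOn φ U
  pullback_eq : ∀ z ∈ U, ∀ u v : E, Ω (fderiv ℝ φ z u) (fderiv ℝ φ z v) = Ω u v

namespace IsSymplecticOn

variable {E : Type*} [NormedAddCommGroup E] [NormedSpace ℝ E] {Ω : E → E → ℝ} {U V : Set E}
  {φ ψ : E → E}

theorem differentiableAt (h : IsSymplecticOn Ω U φ) (hU : IsOpen U) {z : E} (hz : z ∈ U) :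
    DifferentiableAt ℝ φ z :=
  (h.contDiffOn.contDiffAt (hU.mem_nhds hz)).differentiableAt (by simp)

theorem id (U : Set E) : IsSymplecticOn Ω U id :=
  ⟨contDiffOn_id, injOn_id U, fun z _ u v => by simp⟩

theorem comp (hψ : IsSymplecticOn Ω V ψ) (hφ : IsSymplecticOn Ω U φ) (hU : IsOpen U)
    (hV : IsOpen V) (hUV : MapsTo φ U V) : IsSymplecticOn Ω U (ψ ∘ φ) where
  contDiffOn := hψ.contDiffOn.comp hφ.contDiffOn hUV
  injOn := hψ.injOn.comp hφ.injOn hUV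
  pullback_eq z hz u v := by
    rw [fderiv_comp z (hψ.differentiableAt hV (hUV hz)) (hφ.differentiableAt hU hz)]
    simp only [ContinuousLinearMap.comp_apply]
    rw [hψ.pullback_eq _ (hUV hz), hφ.pullback_eq _ hz]

end IsSymplecticOn

/-- The standard area form of the plane. -/
def areaForm (u v : ℂ) : ℝ := u.im * v.re - u.re * v.im

theorem standardForm_eq_sum_areaForm {n : ℕ} (u v : Fin n → ℂ) :
    standardForm u v = ∑ k, areaForm (u k) (v k) := rfl

/-- Pairing `u` with `i u` gives `-‖u‖²` in the Euclidean norm. -/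
theorem eq_zero_of_standardForm_eq_zero {n : ℕ} {u : Fin n → ℂ}
    (h : ∀ v, standardForm u v = 0) : u = 0 := by
  have h0 := h fun k => Complex.I * u k
  have h1 : standardForm u (fun k => Complex.I * u k) = -∑ k, ‖u k‖ ^ 2 := by
    rw [standardForm, ← Finset.sum_neg_distrib]
    refine Finset.sum_congr rfl fun k _ => ?_
    rw [← Complex.normSq_eq_norm_sq, Complex.normSq_apply]
    simp
    ring
  rw [h1, neg_eq_zero, Finset.sum_eq_zero_iff_of_nonneg fun k _ => by positivity] at h0
  funext k
  simpa using h0 k (Finset.mem_univ k)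

/-- Preserving a nondegenerate form makes the derivative injective, hence invertible by dimension.
The inverse function theorem then makes the map open. -/
theorem IsSymplecticOn.isEmbedding {n : ℕ} {U : Set (Fin n → ℂ)} {φ : (Fin n → ℂ) → Fin n → ℂ}
    (h : IsSymplecticOn standardForm U φ) (hU : IsOpen U) :
    Topology.IsEmbedding (U.domRestrict φ) := by
  refine (IsOpenEmbedding.of_continuous_injective_isOpenMap
    (continuousOn_iff_continuous_domRestrict.1 h.contDiffOn.continuousOn)
    (injOn_iff_injective.1 h.injOn) ?_).isEmbedding
  rw [isOpenMap_iff_nhds_le]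
  rintro ⟨z, hz⟩
  have hinj : Function.Injective (fderiv ℝ φ z) := by
    rw [injective_iff_map_eq_zero]
    intro u hu
    refine eq_zero_of_standardForm_eq_zero fun v => ?_
    rw [← h.pullback_eq z hz, hu]
    simp [standardForm]
  let e : (Fin n → ℂ) ≃L[ℝ] (Fin n → ℂ) :=
    (LinearEquiv.ofInjectiveEndo (fderiv ℝ φ z : (Fin n → ℂ) →ₗ[ℝ] _)
      hinj).toContinuousLinearEquiv
  have he : (e : (Fin n → ℂ) →L[ℝ] (Fin n → ℂ)) = fderiv ℝ φ z := by ext; rfl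
  have hs : HasStrictFDerivAt φ (e : (Fin n → ℂ) →L[ℝ] (Fin n → ℂ)) z := by
    rw [he]
    exact (h.contDiffOn.contDiffAt (hU.mem_nhds hz)).hasStrictFDerivAt (by simp)
  have hmap := hs.map_nhds_eq_of_equiv
  change 𝓝 (φ z) ≤ map (φ ∘ Subtype.val) (𝓝 (⟨z, hz⟩ : U))
  rw [← Filter.map_map, map_nhds_subtype_coe_eq_nhds hz (hU.mem_nhds hz), hmap]

/-- The product of area-preserving maps preserves the standard form. -/
theorem IsSymplecticOn.pi {n : ℕ} {U : Fin n → Set ℂ} {σ : Fin n → ℂ → ℂ}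
    (h : ∀ k, IsSymplecticOn areaForm (U k) (σ k)) (hU : ∀ k, IsOpen (U k)) :
    IsSymplecticOn standardForm (univ.pi U) (fun z k => σ k (z k)) where
  contDiffOn := contDiffOn_pi.2 fun k =>
    (h k).contDiffOn.comp (contDiff_apply ℝ ℂ k).contDiffOn fun z hz => hz k (mem_univ k)
  injOn z hz w hw hzw := funext fun k =>
    (h k).injOn (hz k (mem_univ k)) (hw k (mem_univ k)) (congrFun hzw k)
  pullback_eq z hz u v := by
    have hd : ∀ k, HasFDerivAt (fun z : Fin n → ℂ => σ k (z k))
        ((fderiv ℝ (σ k) (z k)).comp (ContinuousLinearMap.proj k)) z := fun k =>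
      ((h k).differentiableAt (hU k) (hz k (mem_univ k))).hasFDerivAt.comp z
        (ContinuousLinearMap.proj (R := ℝ) (φ := fun _ : Fin n => ℂ) k).hasFDerivAt
    rw [(hasFDerivAt_pi.2 hd).fderiv, standardForm_eq_sum_areaForm, standardForm_eq_sum_areaForm]
    refine Finset.sum_congr rfl fun k _ => ?_
    exact (h k).pullback_eq _ (hz k (mem_univ k)) _ _

/-! ### Planar maps -/

section Components

variable {E : Type*} [NormedAddCommGroup E] [NormedSpace ℝ E]

theorem contDiffOn_complex_mk {A B : E → ℝ} {U : Set E} (hA : ContDiffOn ℝ ∞ A U)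
    (hB : ContDiffOn ℝ ∞ B U) : ContDiffOn ℝ ∞ (fun z => (⟨A z, B z⟩ : ℂ)) U :=
  Complex.equivRealProdCLM.symm.contDiff.comp_contDiffOn (hA.prodMk hB)

theorem hasFDerivAt_complex_mk {A B : E → ℝ} {A' B' : E →L[ℝ] ℝ} {z : E}
    (hA : HasFDerivAt A A' z) (hB : HasFDerivAt B B' z) :
    HasFDerivAt (fun z => (⟨A z, B z⟩ : ℂ))
      ((Complex.equivRealProdCLM.symm : ℝ × ℝ →L[ℝ] ℂ).comp (A'.prod B')) z :=
  Complex.equivRealProdCLM.symm.hasFDerivAt.comp z (hA.prodMk hB)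

theorem areaForm_equivRealProdCLM_symm (p q : ℝ × ℝ) :
    areaForm (Complex.equivRealProdCLM.symm p) (Complex.equivRealProdCLM.symm q) =
      p.2 * q.1 - p.1 * q.2 := by
  simp [areaForm]

end Components

/-- The cotangent lift of a primitive `h` of the positive function `l`. -/
theorem isSymplecticOn_lift {l h : ℝ → ℝ} (hl : ContDiff ℝ ∞ l) (hh : ContDiff ℝ ∞ h)
    (hd : ∀ x, HasDerivAt h (l x) x) (hpos : ∀ x, 0 < l x) :
    IsSymplecticOn areaForm univ (fun z : ℂ => (⟨h z.re, z.im / l z.re⟩ : ℂ)) where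
  contDiffOn := contDiffOn_complex_mk (hh.comp Complex.reCLM.contDiff).contDiffOn
    ((Complex.imCLM.contDiff.div (hl.comp Complex.reCLM.contDiff)
      fun z => (hpos _).ne').contDiffOn)
  injOn z _ w _ hzw := by
    have h1 : h z.re = h w.re := congrArg Complex.re hzw
    have h2 : z.im / l z.re = w.im / l w.re := congrArg Complex.im hzw
    have hmono : StrictMono h := strictMono_of_deriv_pos fun x => by rw [(hd x).deriv]; exact hpos x
    have hre := hmono.injective h1
    rw [hre, div_left_inj' (hpos _).ne'] at h2
    exact Complex.ext hre h2
  pullback_eq z _ u v := by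
    have h1 : HasFDerivAt (fun z : ℂ => h z.re) (l z.re • Complex.reCLM) z :=
      (hd z.re).comp_hasFDerivAt z Complex.reCLM.hasFDerivAt
    have h2 : HasFDerivAt (fun z : ℂ => (l z.re)⁻¹)
        ((-deriv l z.re / l z.re ^ 2) • Complex.reCLM) z :=
      (((hl.differentiable (by simp)) z.re).hasDerivAt.fun_inv (hpos _).ne').comp_hasFDerivAt z
        Complex.reCLM.hasFDerivAt
    have h0 : HasFDerivAt (fun z : ℂ => z.im) Complex.imCLM z := Complex.imCLM.hasFDerivAt
    have h3 := h0.fun_mul h2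
    simp only [div_eq_mul_inv]
    rw [(hasFDerivAt_complex_mk h1 h3).fderiv]
    simp only [ContinuousLinearMap.comp_apply, ContinuousLinearEquiv.coe_coe,
      areaForm_equivRealProdCLM_symm, ContinuousLinearMap.prod_apply]
    have := (hpos z.re).ne'
    simp [areaForm]
    field_simp
    ring

/-- The cotangent lift of a primitive `g` of the positive function `l`, with the roles of the two
coordinates exchanged. -/
theorem isSymplecticOn_lift_im {l g : ℝ → ℝ} (hl : ContDiff ℝ ∞ l) (hg : ContDiff ℝ ∞ g)
    (hd : ∀ x, HasDerivAt g (l x) x) (hpos : ∀ x, 0 < l x) :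
    IsSymplecticOn areaForm univ (fun z : ℂ => (⟨z.re / l z.im, g z.im⟩ : ℂ)) where
  contDiffOn := contDiffOn_complex_mk ((Complex.reCLM.contDiff.div
    (hl.comp Complex.imCLM.contDiff) fun z => (hpos _).ne').contDiffOn)
      (hg.comp Complex.imCLM.contDiff).contDiffOn
  injOn z _ w _ hzw := by
    have h1 : z.re / l z.im = w.re / l w.im := congrArg Complex.re hzw
    have h2 : g z.im = g w.im := congrArg Complex.im hzw
    have hmono : StrictMono g := strictMono_of_deriv_pos fun x => by rw [(hd x).deriv]; exact hpos x
    have him := hmono.injective h2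
    rw [him, div_left_inj' (hpos _).ne'] at h1
    exact Complex.ext h1 him
  pullback_eq z _ u v := by
    have h1 : HasFDerivAt (fun z : ℂ => g z.im) (l z.im • Complex.imCLM) z :=
      (hd z.im).comp_hasFDerivAt z Complex.imCLM.hasFDerivAt
    have h2 : HasFDerivAt (fun z : ℂ => (l z.im)⁻¹)
        ((-deriv l z.im / l z.im ^ 2) • Complex.imCLM) z :=
      (((hl.differentiable (by simp)) z.im).hasDerivAt.fun_inv (hpos _).ne').comp_hasFDerivAt z
        Complex.imCLM.hasFDerivAt
    have h0 : HasFDerivAt (fun z : ℂ => z.re) Complex.reCLM z := Complex.reCLM.hasFDerivAt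
    have h3 := h0.fun_mul h2
    simp only [div_eq_mul_inv]
    rw [(hasFDerivAt_complex_mk h3 h1).fderiv]
    simp only [ContinuousLinearMap.comp_apply, ContinuousLinearEquiv.coe_coe,
      areaForm_equivRealProdCLM_symm, ContinuousLinearMap.prod_apply]
    have := (hpos z.im).ne'
    simp [areaForm]
    field_simp
    ring

/-- The plane embeds into the half-strip `(0, ∞) × (0, 1 + δ)` by an area-preserving map that sends
the disc of area `a` into `(0, a + δ) × (0, 1 + δ)`. -/
theorem exists_isSymplecticOn_halfStrip {a δ : ℝ} (ha : 0 < a) (hδ : 0 < δ) :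
    ∃ σ : ℂ → ℂ, IsSymplecticOn areaForm univ σ ∧
      (∀ z, 0 < (σ z).re ∧ 0 < (σ z).im ∧ (σ z).im < 1 + δ) ∧
      ∀ z, Real.pi * ‖z‖ ^ 2 < a → (σ z).re < a + δ := by
  set R := √(a / Real.pi) with hRdef
  have hR : 0 < R := by positivity
  have hR2 : Real.pi * R ^ 2 = a := by
    rw [hRdef, Real.sq_sqrt (by positivity)]
    field_simp
  obtain ⟨hci, hcint⟩ := integral_chord hR
  -- As `l` exceeds the chord length, dividing `im` by `l` brings the disc into `|im| < 1/2`, while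
  -- `h` takes values in `(0, a + δ)`.
  obtain ⟨l, h, hl, hh, hhd, hlb, hhb⟩ := exists_smooth_majorant
    (f := fun x : ℝ => 2 * √(R ^ 2 - x ^ 2)) (by fun_prop) (fun x => by positivity) hci hδ
  -- The second lift compresses the imaginary axis into `(0, 1 + δ)`. Its density `m` exceeds `1` on
  -- `[-1/2, 1/2]`, so over the image of the disc the real part only shrinks.
  obtain ⟨f, hf, hf01, hf1, hfi, hfint⟩ :=
    exists_plateau (lo := -(1 / 2)) (hi := 1 / 2) (by norm_num) (half_pos hδ)
  obtain ⟨m, g, hm, hg, hgd, hmb, hgb⟩ :=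
    exists_smooth_majorant hf (fun x => (hf01 x).1) hfi (half_pos hδ)
  have hlpos : ∀ x, 0 < l x := fun x =>
    lt_of_le_of_lt (by positivity : (0 : ℝ) ≤ 2 * √(R ^ 2 - x ^ 2)) (hlb x).1
  have hmpos : ∀ x, 0 < m x := fun x => (hf01 x).1.trans_lt (hmb x).1
  refine ⟨_, (isSymplecticOn_lift_im hm hg hgd hmpos).comp (isSymplecticOn_lift hl hh hhd hlpos)
    isOpen_univ isOpen_univ (mapsTo_univ _ _), fun z => ⟨?_, ?_, ?_⟩, fun z hz => ?_⟩
  · exact div_pos (hhb _).1 (hmpos _)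
  · exact (hgb _).1
  · exact (hgb _).2.trans_le (by linarith)
  · have hzR : z.re ^ 2 + z.im ^ 2 < R ^ 2 := by
      rw [← hR2, ← Complex.normSq_eq_norm_sq, Complex.normSq_apply] at hz
      nlinarith [lt_of_mul_lt_mul_left hz Real.pi_pos.le]
    have him : |z.im| < l z.re / 2 := by
      have : |z.im| < √(R ^ 2 - z.re ^ 2) := by
        rw [← Real.sqrt_sq_eq_abs]
        exact Real.sqrt_lt_sqrt (sq_nonneg _) (by linarith)
      linarith [(hlb z.re).1]
    have hq : z.im / l z.re ∈ Icc (-(1 / 2) : ℝ) (1 / 2) := by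
      rw [mem_Icc, ← abs_le, abs_div, abs_of_pos (hlpos _), div_le_iff₀ (hlpos _)]
      linarith
    have hm1 : 1 < m (z.im / l z.re) := hf1 _ hq ▸ (hmb _).1
    have : h z.re / m (z.im / l z.re) < h z.re := div_lt_self (hhb _).1 hm1
    refine this.trans ?_
    rw [← hR2, ← hcint]
    exact (hhb _).2

/-- Symplectic polar coordinates of total angle `κ`. -/
theorem exists_isSymplecticOn_polar {κ : ℝ} (hκ : 0 < κ) :
    ∃ τ : ℂ → ℂ, IsSymplecticOn areaForm {z | 0 < z.re ∧ 0 < z.im ∧ z.im < κ} τ ∧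
      ∀ z, 0 < z.re → Real.pi * ‖τ z‖ ^ 2 = κ * z.re := by
  set ρ : ℂ → ℝ := fun z => √(κ / Real.pi * z.re) with hρ
  set θ : ℂ → ℝ := fun z => 2 * Real.pi / κ * z.im with hθ
  have hpi := Real.pi_pos
  have hnorm : ∀ z : ℂ, ‖(⟨ρ z * Real.cos (θ z), ρ z * Real.sin (θ z)⟩ : ℂ)‖ ^ 2 = ρ z ^ 2 := by
    intro z
    rw [← Complex.normSq_eq_norm_sq, Complex.normSq_apply]
    linear_combination ρ z ^ 2 * Real.sin_sq_add_cos_sq (θ z)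
  have hρ2 : ∀ z : ℂ, 0 < z.re → ρ z ^ 2 = κ / Real.pi * z.re := fun z hz => by
    rw [hρ, Real.sq_sqrt (by positivity)]
  have hθd : ∀ z : ℂ, HasFDerivAt θ ((2 * Real.pi / κ) • Complex.imCLM) z := fun z =>
    (Complex.imCLM.hasFDerivAt (x := z)).const_mul _
  refine ⟨fun z => ⟨ρ z * Real.cos (θ z), ρ z * Real.sin (θ z)⟩, ⟨?_, ?_, ?_⟩, fun z hz => ?_⟩
  · have h1 : ContDiffOn ℝ ∞ ρ {z | 0 < z.re ∧ 0 < z.im ∧ z.im < κ} :=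
      (contDiff_const.mul Complex.reCLM.contDiff).contDiffOn.sqrt
        fun z hz => (mul_pos (by positivity) hz.1).ne'
    have h2 : ContDiff ℝ ∞ θ := contDiff_const.mul Complex.imCLM.contDiff
    exact contDiffOn_complex_mk (h1.mul h2.cos.contDiffOn) (h1.mul h2.sin.contDiffOn)
  · intro z hz w hw hzw
    have h1 : ρ z * Real.cos (θ z) = ρ w * Real.cos (θ w) := congrArg Complex.re hzw
    have h2 : ρ z * Real.sin (θ z) = ρ w * Real.sin (θ w) := congrArg Complex.im hzw
    have hρz : 0 < ρ z := Real.sqrt_pos.2 (mul_pos (by positivity) hz.1)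
    have hsq : ρ z ^ 2 = ρ w ^ 2 := by
      rw [← hnorm z, ← hnorm w]
      exact congrArg (‖·‖ ^ 2) hzw
    have hρe : ρ z = ρ w :=
      (pow_left_inj₀ hρz.le (Real.sqrt_nonneg _) two_ne_zero).1 hsq
    rw [hρ2 z hz.1, hρ2 w hw.1] at hsq
    rw [← hρe] at h1 h2
    have hcos := mul_left_cancel₀ hρz.ne' h1
    have hsin := mul_left_cancel₀ hρz.ne' h2
    obtain ⟨j, hj⟩ := Real.Angle.angle_eq_iff_two_pi_dvd_sub.1
      (Real.Angle.cos_sin_inj hcos hsin)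
    -- Equality of angles modulo `2π` becomes equality of imaginary parts modulo `κ`. Both lie in
    -- `(0, κ)`, so `j = 0`.
    have hj' : z.im - w.im = κ * j := by
      simp only [hθ] at hj
      field_simp at hj
      linarith
    have hj0 : j = 0 := by
      have h3 : (j : ℝ) < 1 := by
        by_contra hc
        nlinarith [hz.2.2, hw.2.1]
      have h4 : (-1 : ℝ) < j := by
        by_contra hc
        nlinarith [hw.2.2, hz.2.1]
      have h5 : j < 1 := by exact_mod_cast h3
      have h6 : -1 < j := by exact_mod_cast h4
      omega
    refine Complex.ext (mul_left_cancel₀ (by positivity : κ / Real.pi ≠ 0) hsq) ?_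
    rw [hj0] at hj'
    simp at hj'
    linarith
  · intro z hz u v
    have hρz : 0 < ρ z := Real.sqrt_pos.2 (mul_pos (by positivity) hz.1)
    have h0 : HasFDerivAt ρ
        ((1 / (2 * ρ z)) • ((κ / Real.pi) • Complex.reCLM : ℂ →L[ℝ] ℝ)) z :=
      ((Complex.reCLM.hasFDerivAt (x := z)).const_mul (κ / Real.pi)).sqrt
        (mul_pos (by positivity) hz.1).ne'
    have h1 := h0.fun_mul (hθd z).cos
    have h2 := h0.fun_mul (hθd z).sin
    rw [(hasFDerivAt_complex_mk h1 h2).fderiv]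
    simp only [ContinuousLinearMap.comp_apply, ContinuousLinearEquiv.coe_coe,
      areaForm_equivRealProdCLM_symm, ContinuousLinearMap.prod_apply]
    simp [areaForm]
    field_simp
    linear_combination (4 * ρ z ^ 2 * Real.pi ^ 2 * κ ^ 2) * (u.im * v.re - u.re * v.im) *
      Real.sin_sq_add_cos_sq (θ z)
  · rw [hnorm, hρ2 z hz]
    field_simp

/-! ### The cotangent lift of `x ↦ (T_k(x_k) - T_o(x_o))_{k ≠ o}, ∑ V_k(x_k)` -/

section CotangentLift

variable {m : ℕ} (o : Fin m) (T V t v : Fin m → ℝ → ℝ)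

/-- The momentum conjugate to `∑ V_k(x_k)`; here `t_k`, `v_k` are the derivatives of `T_k`, `V_k`. -/
noncomputable def sumMomentum (z : Fin m → ℂ) : ℝ :=
  (∑ k, (z k).im / t k (z k).re) / ∑ k, v k (z k).re / t k (z k).re

/-- The momentum conjugate to `T_k(x_k) - T_o(x_o)`. -/
noncomputable def diffMomentum (k : Fin m) (z : Fin m → ℂ) : ℝ :=
  ((z k).im - v k (z k).re * sumMomentum t v z) / t k (z k).re

/-- The cotangent lift of the map with components `∑ V_k(x_k)` at `o` and `T_k(x_k) - T_o(x_o)` at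
`k ≠ o`. -/
noncomputable def cotangentLift (z : Fin m → ℂ) (k : Fin m) : ℂ :=
  if k = o then ⟨∑ j, V j (z j).re, sumMomentum t v z⟩
  else ⟨T k (z k).re - T o (z o).re, diffMomentum t v k z⟩

variable {o T V t v}

/-- This is the rule for pulling back the momentum covector, and the relation that is differentiated
to prove symplecticity. -/
theorem im_eq_momenta (ht0 : ∀ k x, 0 < t k x) (k : Fin m) (z : Fin m → ℂ) :
    (z k).im = t k (z k).re * diffMomentum t v k z + v k (z k).re * sumMomentum t v z := by
  have := (ht0 k (z k).re).ne'
  rw [diffMomentum]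
  field_simp
  ring

theorem sum_div_pos (o : Fin m) (ht0 : ∀ k x, 0 < t k x) (hv0 : ∀ k x, 0 < v k x)
    (z : Fin m → ℂ) : 0 < ∑ k, v k (z k).re / t k (z k).re :=
  Finset.sum_pos (fun _ _ => div_pos (hv0 _ _) (ht0 _ _)) ⟨o, Finset.mem_univ o⟩

/-- There is no position conjugate to index `o`. Its momentum is minus the sum of the others,
because `T o` enters every difference with a minus sign. This constraint dictates the formula for
`sumMomentum`. -/
theorem sum_diffMomentum (o : Fin m) (ht0 : ∀ k x, 0 < t k x) (hv0 : ∀ k x, 0 < v k x)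
    (z : Fin m → ℂ) : ∑ k, diffMomentum t v k z = 0 := by
  have h := (sum_div_pos o ht0 hv0 z).ne'
  have h1 : ∀ k, diffMomentum t v k z = (z k).im / t k (z k).re -
      v k (z k).re / t k (z k).re * sumMomentum t v z := fun k => by
    rw [diffMomentum]; ring
  simp only [h1, Finset.sum_sub_distrib, ← Finset.sum_mul]
  rw [sumMomentum, mul_div_cancel₀ _ h, sub_self]

theorem contDiff_comp_re {f : ℝ → ℝ} (hf : ContDiff ℝ ∞ f) (k : Fin m) :
    ContDiff ℝ ∞ fun z : Fin m → ℂ => f (z k).re :=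
  hf.comp (Complex.reCLM.contDiff.comp (contDiff_apply ℝ ℂ k))

theorem contDiff_im_apply (k : Fin m) : ContDiff ℝ ∞ fun z : Fin m → ℂ => (z k).im :=
  Complex.imCLM.contDiff.comp (contDiff_apply ℝ ℂ k)

theorem hasFDerivAt_comp_re {f : ℝ → ℝ} {f' : ℝ} (k : Fin m) (z : Fin m → ℂ)
    (hf : HasDerivAt f f' (z k).re) :
    HasFDerivAt (fun z : Fin m → ℂ => f (z k).re)
      (f' • Complex.reCLM.comp (ContinuousLinearMap.proj k)) z :=
  hf.comp_hasFDerivAt z (Complex.reCLM.comp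
    (ContinuousLinearMap.proj (R := ℝ) (φ := fun _ : Fin m => ℂ) k)).hasFDerivAt

theorem contDiff_sumMomentum (o : Fin m) (ht : ∀ k, ContDiff ℝ ∞ (t k))
    (hv : ∀ k, ContDiff ℝ ∞ (v k)) (ht0 : ∀ k x, 0 < t k x) (hv0 : ∀ k x, 0 < v k x) :
    ContDiff ℝ ∞ (sumMomentum t v) :=
  (ContDiff.sum fun k _ => (contDiff_im_apply k).div (contDiff_comp_re (ht k) k)
    fun _ => (ht0 _ _).ne').div (ContDiff.sum fun k _ => (contDiff_comp_re (hv k) k).div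
      (contDiff_comp_re (ht k) k) fun _ => (ht0 _ _).ne') fun z => (sum_div_pos o ht0 hv0 z).ne'

theorem contDiff_diffMomentum (ht : ∀ k, ContDiff ℝ ∞ (t k))
    (hv : ∀ k, ContDiff ℝ ∞ (v k)) (ht0 : ∀ k x, 0 < t k x) (hv0 : ∀ k x, 0 < v k x) (k : Fin m) :
    ContDiff ℝ ∞ (diffMomentum t v k) :=
  ((contDiff_im_apply k).sub ((contDiff_comp_re (hv k) k).mul
    (contDiff_sumMomentum k ht hv ht0 hv0))).div (contDiff_comp_re (ht k) k)
      fun _ => (ht0 _ _).ne'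

theorem cotangentLift_injective (hTm : ∀ k, StrictMono (T k)) (hVm : ∀ k, StrictMono (V k))
    (ht0 : ∀ k x, 0 < t k x) (hv0 : ∀ k x, 0 < v k x) :
    Function.Injective (cotangentLift o T V t v) := by
  intro z w h
  have ho : (⟨∑ j, V j (z j).re, sumMomentum t v z⟩ : ℂ) =
      ⟨∑ j, V j (w j).re, sumMomentum t v w⟩ := by
    simpa [cotangentLift] using congrFun h o
  have hk : ∀ k, k ≠ o → (⟨T k (z k).re - T o (z o).re, diffMomentum t v k z⟩ : ℂ) =
      ⟨T k (w k).re - T o (w o).re, diffMomentum t v k w⟩ := fun k hk => by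
    simpa [cotangentLift, hk] using congrFun h k
  have hV : ∑ j, V j (z j).re = ∑ j, V j (w j).re := congrArg Complex.re ho
  have hQ : sumMomentum t v z = sumMomentum t v w := congrArg Complex.im ho
  have hT : ∀ k, T k (z k).re - T o (z o).re = T k (w k).re - T o (w o).re := fun k => by
    by_cases hko : k = o
    · rw [hko]; ring
    · exact congrArg Complex.re (hk k hko)
  have hq : ∀ k, diffMomentum t v k z = diffMomentum t v k w := by
    have h1 : ∀ k, k ≠ o → diffMomentum t v k z = diffMomentum t v k w := fun k hko =>
      congrArg Complex.im (hk k hko)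
    intro k
    by_cases hko : k = o
    · have hz := sum_diffMomentum o ht0 hv0 z
      have hw := sum_diffMomentum o ht0 hv0 w
      rw [← Finset.add_sum_erase _ _ (Finset.mem_univ o)] at hz hw
      rw [Finset.sum_congr rfl fun k hk => h1 k (Finset.ne_of_mem_erase hk)] at hz
      rw [hko]
      linarith
    · exact h1 k hko
  -- With all the differences fixed, raising `x_o` raises every `x_k`, and so `∑ V k (x_k)`
  -- strictly.
  have hlt : ∀ z w : Fin m → ℂ, (∀ k, T k (z k).re - T o (z o).re = T k (w k).re - T o (w o).re) →
      (z o).re < (w o).re → ∑ j, V j (z j).re < ∑ j, V j (w j).re := by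
    intro z w hT hzw
    refine Finset.sum_lt_sum_of_nonempty ⟨o, Finset.mem_univ o⟩ fun k _ => hVm k ?_
    rw [← (hTm k).lt_iff_lt]
    linarith [hTm o hzw, hT k]
  have hre0 : (z o).re = (w o).re := by
    rcases lt_trichotomy (z o).re (w o).re with h1 | h1 | h1
    · exact absurd hV (hlt z w hT h1).ne
    · exact h1
    · exact absurd hV (hlt w z (fun k => (hT k).symm) h1).ne'
  funext k
  have hre : (z k).re = (w k).re := (hTm k).injective (by have := hT k; rw [hre0] at this; linarith)
  refine Complex.ext hre ?_
  rw [im_eq_momenta (v := v) ht0 k z, im_eq_momenta (v := v) ht0 k w, hre, hq, hQ]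

/-- Differentiating `y_k = t_k q_k + v_k Q` gives `dy_k = c dx_k + t_k dq_k + v_k dQ`. In `∑ dy_k ∧
dx_k` the `c` terms drop out, and `∑ dq_k = 0` allows `t_o dx_o` to be subtracted from each `t_k
dx_k`. -/
theorem isSymplecticOn_cotangentLift (hT : ∀ k, ContDiff ℝ ∞ (T k)) (hV : ∀ k, ContDiff ℝ ∞ (V k))
    (ht : ∀ k, ContDiff ℝ ∞ (t k)) (hv : ∀ k, ContDiff ℝ ∞ (v k))
    (hTd : ∀ k x, HasDerivAt (T k) (t k x) x) (hVd : ∀ k x, HasDerivAt (V k) (v k x) x)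
    (ht0 : ∀ k x, 0 < t k x) (hv0 : ∀ k x, 0 < v k x) :
    IsSymplecticOn standardForm univ (cotangentLift o T V t v) where
  contDiffOn := contDiffOn_pi.2 fun k => by
    by_cases hk : k = o
    · simp only [cotangentLift, hk, if_true]
      exact contDiffOn_complex_mk
        (ContDiff.sum fun j _ => contDiff_comp_re (hV j) j).contDiffOn
        (contDiff_sumMomentum o ht hv ht0 hv0).contDiffOn
    · simp only [cotangentLift, hk, if_false]
      exact contDiffOn_complex_mk
        ((contDiff_comp_re (hT k) k).sub (contDiff_comp_re (hT o) o)).contDiffOn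
        (contDiff_diffMomentum ht hv ht0 hv0 k).contDiffOn
  injOn := (cotangentLift_injective
    (fun k => strictMono_of_deriv_pos fun x => by rw [(hTd k x).deriv]; exact ht0 k x)
    (fun k => strictMono_of_deriv_pos fun x => by rw [(hVd k x).deriv]; exact hv0 k x)
    ht0 hv0).injOn
  pullback_eq z _ u w := by
    have hQ : HasFDerivAt (sumMomentum t v) (fderiv ℝ (sumMomentum t v) z) z :=
      ((contDiff_sumMomentum o ht hv ht0 hv0).differentiable (by simp) z).hasFDerivAt
    have hq : ∀ k, HasFDerivAt (diffMomentum t v k) (fderiv ℝ (diffMomentum t v k) z) z := fun k =>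
      ((contDiff_diffMomentum ht hv ht0 hv0 k).differentiable (by simp) z).hasFDerivAt
    set dQ := fderiv ℝ (sumMomentum t v) z
    set dq := fun k => fderiv ℝ (diffMomentum t v k) z
    have hsum : ∀ u, ∑ k, dq k u = 0 := by
      have h1 : HasFDerivAt (fun z => ∑ k, diffMomentum t v k z) (∑ k, dq k) z :=
        HasFDerivAt.fun_sum fun k _ => hq k
      simp only [sum_diffMomentum o ht0 hv0] at h1
      have h2 := h1.unique (hasFDerivAt_const (0 : ℝ) z)
      intro u
      simpa using congrArg (fun f : (Fin m → ℂ) →L[ℝ] ℝ => f u) h2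
    have him : ∀ k, ∃ c : ℝ, ∀ u : Fin m → ℂ, (u k).im =
        c * (u k).re + t k (z k).re * dq k u + v k (z k).re * dQ u := by
      intro k
      have h1 := ((hasFDerivAt_comp_re k z ((ht k).differentiable (by simp) (z k).re).hasDerivAt
        ).fun_mul (hq k)).fun_add ((hasFDerivAt_comp_re k z
          ((hv k).differentiable (by simp) (z k).re).hasDerivAt).fun_mul hQ)
      have h2 : HasFDerivAt (fun z : Fin m → ℂ => (z k).im)
          (Complex.imCLM.comp (ContinuousLinearMap.proj k)) z :=
        (Complex.imCLM.comp
          (ContinuousLinearMap.proj (R := ℝ) (φ := fun _ : Fin m => ℂ) k)).hasFDerivAt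
      simp only [← im_eq_momenta ht0 k] at h1
      refine ⟨diffMomentum t v k z * deriv (t k) (z k).re +
        sumMomentum t v z * deriv (v k) (z k).re, fun u => ?_⟩
      have h3 := congrArg (fun f : (Fin m → ℂ) →L[ℝ] ℝ => f u) (h2.unique h1)
      simp at h3
      rw [h3]
      ring
    have hd : ∀ k, HasFDerivAt (fun z => cotangentLift o T V t v z k)
        ((Complex.equivRealProdCLM.symm : ℝ × ℝ →L[ℝ] ℂ).comp
          (if k = o then (∑ j, v j (z j).re • Complex.reCLM.comp
            (ContinuousLinearMap.proj (R := ℝ) (φ := fun _ : Fin m => ℂ) j)).prod dQ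
          else (t k (z k).re • Complex.reCLM.comp
            (ContinuousLinearMap.proj (R := ℝ) (φ := fun _ : Fin m => ℂ) k) -
              t o (z o).re • Complex.reCLM.comp (ContinuousLinearMap.proj o)).prod (dq k))) z := by
      intro k
      by_cases hk : k = o
      · simp only [cotangentLift, hk, if_true]
        exact hasFDerivAt_complex_mk
          (HasFDerivAt.fun_sum fun j _ => hasFDerivAt_comp_re j z (hVd j _)) hQ
      · simp only [cotangentLift, hk, if_false]
        exact hasFDerivAt_complex_mk
          ((hasFDerivAt_comp_re k z (hTd k _)).fun_sub (hasFDerivAt_comp_re o z (hTd o _))) (hq k)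
    rw [(hasFDerivAt_pi.2 hd).fderiv, standardForm_eq_sum_areaForm, standardForm_eq_sum_areaForm]
    simp only [ContinuousLinearMap.pi_apply, ContinuousLinearMap.comp_apply,
      ContinuousLinearEquiv.coe_coe, areaForm_equivRealProdCLM_symm]
    set D : ℝ := dQ u * ∑ j, v j (z j).re * (w j).re - (∑ j, v j (z j).re * (u j).re) * dQ w
      with hD
    set c : Fin m → ℝ := fun k =>
      dq k u * (t k (z k).re * (w k).re - t o (z o).re * (w o).re) -
        (t k (z k).re * (u k).re - t o (z o).re * (u o).re) * dq k w with hc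
    -- Since the term at `o` vanishes, the sum over `k ≠ o` can be taken over all `k`, where `hsum`
    -- applies.
    have hco : c o = 0 := by simp [hc]
    trans D + ∑ k, c k
    · rw [← Finset.add_sum_erase _ _ (Finset.mem_univ o),
        ← Finset.add_sum_erase _ c (Finset.mem_univ o), hco, zero_add]
      congr 1
      · simp [hD]
      · refine Finset.sum_congr rfl fun k hk => ?_
        simp [Finset.ne_of_mem_erase hk, hc]
    · have hcs : ∑ k, c k =
          ∑ k, t k (z k).re * (dq k u * (w k).re - (u k).re * dq k w) := by
        have h1 : ∑ k, c k = ∑ k, t k (z k).re * (dq k u * (w k).re - (u k).re * dq k w) -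
            (∑ k, dq k u) * (t o (z o).re * (w o).re) +
              (t o (z o).re * (u o).re) * ∑ k, dq k w := by
          rw [Finset.sum_mul, Finset.mul_sum, ← Finset.sum_sub_distrib, ← Finset.sum_add_distrib]
          refine Finset.sum_congr rfl fun k _ => ?_
          simp only [hc]
          ring
        rw [h1, hsum, hsum]
        ring
      rw [hcs, hD, Finset.mul_sum, Finset.sum_mul, ← Finset.sum_sub_distrib,
        ← Finset.sum_add_distrib]
      refine Finset.sum_congr rfl fun k _ => ?_
      obtain ⟨b, hb⟩ := him k
      rw [areaForm, hb u, hb w]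
      ring

end CotangentLift

/-! ### The embedding -/

/-- A smooth approximation `v` of the indicator function of `[0, a + δ]` with a primitive `V`. -/
theorem exists_profile {a δ : ℝ} (ha : 0 < a) (hδ : 0 < δ) (hδ1 : δ < 1) :
    ∃ v V : ℝ → ℝ, ContDiff ℝ ∞ v ∧ ContDiff ℝ ∞ V ∧ (∀ x, HasDerivAt V (v x) x) ∧
      (∀ x, 0 < v x ∧ v x < 1) ∧ (∀ x ∈ Icc 0 (a + δ), 1 - δ < v x) ∧
      ∀ x, 0 < V x ∧ V x < a + 3 * δ := by
  obtain ⟨f, hf, hf01, hf1, hfi, hfint⟩ :=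
    exists_plateau (lo := 0) (hi := a + δ) (by linarith) hδ
  -- Scaling the plateau by `1 - δ` leaves room for the error `δ` below the ceiling `1`.
  have h1 : 0 < 1 - δ := by linarith
  obtain ⟨v, V, hv, hV, hVd, hvb, hVb⟩ := exists_smooth_majorant (f := fun x => (1 - δ) * f x)
    (continuous_const.mul hf) (fun x => mul_nonneg h1.le (hf01 x).1) (hfi.const_mul (1 - δ)) hδ
  refine ⟨v, V, hv, hV, hVd, fun x => ⟨?_, ?_⟩, fun x hx => ?_, fun x => ⟨(hVb x).1, ?_⟩⟩
  · exact (mul_nonneg h1.le (hf01 x).1).trans_lt (hvb x).1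
  · nlinarith [(hvb x).2, (hf01 x).2]
  · have := (hvb x).1
    rwa [hf1 x hx, mul_one] at this
  · have h2 : ∫ x, f x ≥ 0 := integral_nonneg fun x => (hf01 x).1
    have := (hVb x).2
    rw [integral_const_mul] at this
    nlinarith

/-- Since `1 ≤ v k + t k`, one has `∑ 1 / t k ≤ S + m` with `S = ∑ v k / t k`. The single large term
at `j` makes `m` negligible against `S`. -/
theorem sumMomentum_bounds {m : ℕ} {v : Fin m → ℝ → ℝ} {δ W : ℝ} (hδ : 0 < δ)
    (hδ1 : δ < 1 / 2) (hv : ∀ k x, 0 < v k x ∧ v k x < 1) {z : Fin m → ℂ}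
    (hz : ∀ k, 0 < (z k).im ∧ (z k).im < W) {j : Fin m} (hj : 1 - δ < v j (z j).re) :
    0 < sumMomentum (fun k x => 1 + δ - v k x) v z ∧
      sumMomentum (fun k x => 1 + δ - v k x) v z < W * (1 + 4 * δ * m) := by
  have ht : ∀ k, 0 < 1 + δ - v k (z k).re := fun k => by linarith [(hv k (z k).re).2]
  have hne : (Finset.univ : Finset (Fin m)).Nonempty := ⟨j, Finset.mem_univ j⟩
  have hW : 0 < W := (hz j).1.trans (hz j).2
  set S := ∑ k, v k (z k).re / (1 + δ - v k (z k).re) with hS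
  have hterm : ∀ k, 0 < v k (z k).re / (1 + δ - v k (z k).re) := fun k =>
    div_pos (hv k _).1 (ht k)
  have hS0 : 0 < S := Finset.sum_pos (fun k _ => hterm k) hne
  -- Here `v j > 1 - δ > 1/2` and `t j < 2δ`, so the term at `j` alone exceeds `1 / (4δ)`.
  have hSj : 1 ≤ 4 * δ * S := by
    have h1 : v j (z j).re / (1 + δ - v j (z j).re) ≤ S :=
      Finset.single_le_sum (fun k _ => (hterm k).le) (Finset.mem_univ j)
    rw [div_le_iff₀ (ht j)] at h1
    nlinarith
  have hinv : ∑ k, 1 / (1 + δ - v k (z k).re) ≤ (1 + 4 * δ * m) * S := by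
    calc ∑ k, 1 / (1 + δ - v k (z k).re)
        ≤ ∑ k, (v k (z k).re / (1 + δ - v k (z k).re) + 1) := by
          refine Finset.sum_le_sum fun k _ => ?_
          rw [div_add_one (ht k).ne']
          exact div_le_div_of_nonneg_right (by linarith) (ht k).le
      _ = S + m := by simp [Finset.sum_add_distrib, hS]
      _ ≤ (1 + 4 * δ * m) * S := by nlinarith [(Nat.cast_nonneg m : (0 : ℝ) ≤ m)]
  refine ⟨div_pos (Finset.sum_pos (fun k _ => div_pos (hz k).1 (ht k)) hne) hS0, ?_⟩
  rw [sumMomentum, div_lt_iff₀ hS0]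
  calc ∑ k, (z k).im / (1 + δ - v k (z k).re)
      < ∑ k, W * (1 / (1 + δ - v k (z k).re)) := by
        refine Finset.sum_lt_sum_of_nonempty hne fun k _ => ?_
        rw [mul_one_div]
        exact div_lt_div_of_pos_right (hz k).2 (ht k)
    _ = W * ∑ k, 1 / (1 + δ - v k (z k).re) := by rw [Finset.mul_sum]
    _ ≤ W * ((1 + 4 * δ * m) * S) := mul_le_mul_of_nonneg_left hinv hW.le
    _ = W * (1 + 4 * δ * m) * S := by ring

theorem mem_lShaped {n : ℕ} {a : Fin n → ℝ} {z : Fin n → ℂ} :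
    z ∈ lShaped a ↔ ∃ k, Real.pi * ‖z k‖ ^ 2 < a k := by
  have : ∀ j, 0 ≤ Real.pi * ‖z j‖ ^ 2 := fun j => by positivity
  simp [lShaped, toricDomain, momentMap, this]

theorem isOpen_lShaped {n : ℕ} (a : Fin n → ℝ) : IsOpen (lShaped a) := by
  have : lShaped a = ⋃ k, {z | Real.pi * ‖z k‖ ^ 2 < a k} := by
    ext z; simp [mem_lShaped]
  rw [this]
  exact isOpen_iUnion fun k => isOpen_lt (by fun_prop) continuous_const

theorem mem_cylinder {n : ℕ} {r : ℝ} {z : Fin (n + 1) → ℂ} :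
    z ∈ cylinder n r ↔ Real.pi * ‖z (Fin.last n)‖ ^ 2 < r := by
  have : ∀ j, 0 ≤ Real.pi * ‖z j‖ ^ 2 := fun j => by positivity
  simp [cylinder, toricDomain, momentMap, this]

/-- The left side is continuous in `δ` and equals `S` at `δ = 0`. -/
theorem exists_small_parameter (N : ℝ) {S r : ℝ} (h : S < r) :
    ∃ δ, 0 < δ ∧ δ < 1 / 2 ∧ (1 + δ) * (1 + 4 * δ * N) * (S + 3 * δ * N) < r := by
  have hc : Continuous fun δ : ℝ => (1 + δ) * (1 + 4 * δ * N) * (S + 3 * δ * N) := by fun_prop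
  have h1 : ∀ᶠ δ in 𝓝[>] (0 : ℝ), (1 + δ) * (1 + 4 * δ * N) * (S + 3 * δ * N) < r :=
    (hc.continuousAt.eventually_lt continuousAt_const (by simpa using h)).filter_mono
      nhdsWithin_le_nhds
  have h2 : ∀ᶠ δ in 𝓝[>] (0 : ℝ), δ ∈ Ioo (0 : ℝ) (1 / 2) := Ioo_mem_nhdsGT (by norm_num)
  obtain ⟨δ, h3, h4⟩ := (h1.and h2).exists
  exact ⟨δ, h4.1, h4.2, h3⟩

/-- The `L`-shaped domain embeds symplectically into every cylinder of capacity larger than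
`∑ aₖ`. -/
theorem exists_isSymplecticEmbedding_lShaped_cylinder {n : ℕ} {a : Fin (n + 1) → ℝ}
    (ha : ∀ k, 0 < a k) {r : ℝ} (hr : ∑ k, a k < r) :
    ∃ φ : (Fin (n + 1) → ℂ) → (Fin (n + 1) → ℂ),
      IsSymplecticEmbedding (lShaped a) (Toric.cylinder n r) φ := by
  obtain ⟨δ, hδ, hδ2, hδr⟩ := exists_small_parameter ((n + 1 : ℕ) : ℝ) hr
  choose σ hσ hσb hσa using fun k => exists_isSymplecticOn_halfStrip (ha k) hδ
  choose v V hv hV hVd hvb hva hVb using fun k =>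
    exists_profile (ha k) hδ (by linarith : δ < 1)
  -- This is the bound of `sumMomentum_bounds` with `W = 1 + δ` and `m = n + 1`; as total angle it
  -- lets the polar map accept every value of `Q`.
  set κ : ℝ := (1 + δ) * (1 + 4 * δ * (n + 1 : ℕ)) with hκdef
  have hκ : 0 < κ := by positivity
  obtain ⟨τ, hτ, hτn⟩ := exists_isSymplecticOn_polar hκ
  have hU := isOpen_lShaped a
  have h1 : IsSymplecticOn standardForm (lShaped a) (fun z k => σ k (z k)) := by
    have h := IsSymplecticOn.pi (U := fun _ => univ) hσ fun _ => isOpen_univ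
    rw [pi_univ] at h
    exact ⟨h.contDiffOn.mono (subset_univ _), h.injOn.mono (subset_univ _),
      fun z _ => h.pullback_eq z (mem_univ z)⟩
  set Ψ := cotangentLift (Fin.last n) (fun k x => (1 + δ) * x - V k x) V
    (fun k x => 1 + δ - v k x) v with hΨ
  have h2 : IsSymplecticOn standardForm univ Ψ := by
    refine isSymplecticOn_cotangentLift (fun k => (contDiff_const.mul contDiff_id).sub (hV k)) hV
      (fun k => contDiff_const.sub (hv k)) hv (fun k x => ?_) hVd
      (fun k x => by linarith [(hvb k x).2]) fun k x => (hvb k x).1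
    simpa using ((hasDerivAt_id x).const_mul (1 + δ)).fun_sub (hVd k x)
  let P : Fin (n + 1) → Set ℂ := fun k =>
    if k = Fin.last n then {z | 0 < z.re ∧ 0 < z.im ∧ z.im < κ} else univ
  -- Only the last coordinate is constrained by the cylinder, so the other factors are left alone.
  let ρ : Fin (n + 1) → ℂ → ℂ := fun k => if k = Fin.last n then τ else id
  have hP : ∀ k, IsOpen (P k) := fun k => by
    by_cases hk : k = Fin.last n
    · simp only [P, hk, if_true]
      exact (isOpen_lt continuous_const Complex.continuous_re).inter
        ((isOpen_lt continuous_const Complex.continuous_im).inter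
          (isOpen_lt Complex.continuous_im continuous_const))
    · simp [P, hk]
  have h3 : IsSymplecticOn standardForm (univ.pi P) (fun z k => ρ k (z k)) := by
    refine IsSymplecticOn.pi (fun k => ?_) hP
    by_cases hk : k = Fin.last n
    · simpa only [P, ρ, hk, if_true] using hτ
    · simpa only [P, ρ, hk, if_false] using IsSymplecticOn.id univ
  have hmaps : ∀ z ∈ lShaped a, 0 < (Ψ (fun k => σ k (z k)) (Fin.last n)).re ∧
      (Ψ (fun k => σ k (z k)) (Fin.last n)).re < ∑ k, a k + 3 * δ * (n + 1 : ℕ) ∧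
      0 < (Ψ (fun k => σ k (z k)) (Fin.last n)).im ∧
      (Ψ (fun k => σ k (z k)) (Fin.last n)).im < κ := by
    intro z hz
    obtain ⟨j, hj⟩ := mem_lShaped.1 hz
    have hne : (Finset.univ : Finset (Fin (n + 1))).Nonempty := ⟨j, Finset.mem_univ j⟩
    obtain ⟨hQ0, hQ1⟩ := sumMomentum_bounds hδ hδ2 hvb (z := fun k => σ k (z k))
      (fun k => (hσb k (z k)).2) (hva j _ ⟨(hσb j (z j)).1.le, (hσa j (z j) hj).le⟩)
    simp only [hΨ, cotangentLift, if_true]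
    refine ⟨Finset.sum_pos (fun k _ => (hVb k _).1) hne, ?_, hQ0, hQ1⟩
    calc ∑ k, V k (σ k (z k)).re < ∑ k, (a k + 3 * δ) :=
          Finset.sum_lt_sum_of_nonempty hne fun k _ => (hVb k _).2
      _ = ∑ k, a k + 3 * δ * (n + 1 : ℕ) := by
          simp [Finset.sum_add_distrib]
          ring
  have h4 := h3.comp (h2.comp h1 hU isOpen_univ (mapsTo_univ _ _)) hU
    (isOpen_set_pi finite_univ fun k _ => hP k) fun z hz k _ => by
      obtain ⟨m1, -, m3, m4⟩ := hmaps z hz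
      by_cases hk : k = Fin.last n
      · subst hk
        simp only [P, if_true]
        exact ⟨m1, m3, m4⟩
      · simp [P, hk]
  refine ⟨_, h4.contDiffOn, h4.isEmbedding hU, fun z hz => ?_, h4.pullback_eq⟩
  obtain ⟨m1, m2, -⟩ := hmaps z hz
  rw [Toric.mem_cylinder]
  simp only [Function.comp_apply, ρ, if_true]
  rw [hτn _ m1]
  exact (mul_lt_mul_of_pos_left m2 hκ).trans hδr

end Toric

theorem theorem1p3 (n : ℕ) (a : Fin (n + 1) → ℝ) (ha : ∀ k, 0 < a k)
    (r : ℝ) (hr : ∑ k, a k < r) :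
    ∃ φ : (Fin (n + 1) → ℂ) → (Fin (n + 1) → ℂ),
      Toric.IsSymplecticEmbedding (Toric.lShaped a) (Toric.cylinder n r) φ := by
  exact Toric.exists_isSymplecticEmbedding_lShaped_cylinder ha hr
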